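/- Let $\Bbbk$ be a field. Graphs may have loops and parallel edges; a loop is a cycle of length $1$ and two parallel edges form a cycle of length $2$. A block of a graph is a maximal nonseparable subgraph, where a graph is nonseparable if it is connected and its edge set cannot be partitioned into two nonempty classes such that at most one vertex is incident with edges of both classes. A cactus graph is a finite connected graph in which every block is either a cycle or a single edge. The cycle matroid $M(G)$ of a graph $G$ has the edge set $E_G$ as ground set, and its independent sets are the sets of edges that contain no cycle of $G$. Let $S=\Bbbk[x_e : e\in E_G]$ and $\mathfrak m=\langle x_e : e\in E_G\rangle$. The facet ideal of $M(G)$ is the ideal $\mathcal F(M(G))=\langle \prod_{e\in B}x_e : B \text{ a basis of } M(G)\rangle$ of $S$. A minimal (ungraded) free resolution of an $S$-module $N$ is a complex $0\leftarrow F_0\xleftarrow{\phi_1}F_1\xleftarrow{\phi_2}F_2\leftarrow\cdots$ of finitely generated free $S$-modules that is exact except at $F_0$, with $F_0/\operatorname{im}\phi_1\cong N$ and $\operatorname{im}\phi_i\subseteq\mathfrak m F_{i-1}$ for all $i\ge 1$. **Theorem.** Let $G$ be a cactus graph, and let $C_1,\dots,C_t$, $t\ge 1$, be all its cycles, with $C_v$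 of length $n_v$. Let $\sigma_j=\sum_{1\le k_1<\cdots<k_j\le t}n_{k_1}\cdots n_{k_j}$ (with $\sigma_0=1$) be the elementary symmetric polynomials in $n_1,\dots,n_t$. Then the $S$-module $\mathcal F(M(G))$ has a minimal free resolution of the form $$0\leftarrow S^{\beta_0}\leftarrow S^{\beta_1}\leftarrow\cdots\leftarrow S^{\beta_t}\leftarrow 0,$$ where, for $0\le i\le t$, $$\beta_i=\sum_{j=0}^{i}(-1)^j\binom{t-j}{i-j}\sigma_{t-j}=\sum_{\substack{\Sigma\subseteq\{1,\dots,t\}\\ |\Sigma|=i}}\ \prod_{v\in\Sigma}(n_v-1)\prod_{v\notin\Sigma}n_v .$$ (If $G$ has loops, the last of these ranks may be $0$.) -/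

import Mathlib

namespace Graph

open scoped Graph

variable {α β : Type*}

/-! ### Connected multigraphs, cycles, blocks, cacti

Multigraphs may have loops and parallel edges. A subgraph of `G` is a graph `H` with `H ≤ G`. -/

/-- A multigraph is connected if it has a vertex and any two of its vertices are joined by a
sequence of successively adjacent vertices. -/
def IsConnectedGraph (G : Graph α β) : Prop :=
  V(G).Nonempty ∧ ∀ x ∈ V(G), ∀ y ∈ V(G), Relation.ReflTransGen G.Adj x y

/-- `C` is a cycle of length `n ≥ 1`: its vertices are `n` distinct vertices `v 0, …, v (n - 1)`
and its edges are `n` distinct edges `e 0, …, e (n - 1)`, where `e i` joins `v i` to `v (i + 1)`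
(indices modulo `n`). A loop is a cycle of length `1`, two parallel edges form a cycle of
length `2`. -/
def IsCycleOfLength (C : Graph α β) (n : ℕ) : Prop :=
  n ≠ 0 ∧ ∃ (v : ZMod n → α) (e : ZMod n → β),
    Function.Injective v ∧ Function.Injective e ∧
    Set.range v = V(C) ∧ Set.range e = E(C) ∧ ∀ i, C.IsLink (e i) (v i) (v (i + 1))

/-- `C` is a cycle (of some length). -/
def IsCycleGraph (C : Graph α β) : Prop := ∃ n, C.IsCycleOfLength n

/-- A multigraph is nonseparable if it is connected and its edges cannot be divided into two
nonempty classes such that at most one vertex is incident with edges of both classes. -/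
def IsNonseparable (H : Graph α β) : Prop :=
  H.IsConnectedGraph ∧
    ¬ ∃ A B : Set β, A.Nonempty ∧ B.Nonempty ∧ Disjoint A B ∧ A ∪ B = E(H) ∧
      {x | (∃ e ∈ A, H.Inc e x) ∧ ∃ f ∈ B, H.Inc f x}.Subsingleton

/-- A block of `G` is a maximal nonseparable subgraph of `G`. -/
def IsBlock (G B : Graph α β) : Prop :=
  Maximal (fun H : Graph α β => H ≤ G ∧ H.IsNonseparable) B

/-- A cactus graph is a finite connected multigraph each of whose blocks is either a cycle or a
single edge. -/
structure IsCactus (G : Graph α β) : Prop where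
  finite_vertexSet : V(G).Finite
  finite_edgeSet : E(G).Finite
  connected : G.IsConnectedGraph
  isCycle_or_edge_of_isBlock : ∀ B, G.IsBlock B → B.IsCycleGraph ∨ ∃ e, E(B) = {e}

/-! ### The cycle matroid -/

/-- A set of edges of `G` is acyclic if it does not contain the edge set of a cycle of `G`. -/
def IsAcyclicSet (G : Graph α β) (I : Set β) : Prop :=
  I ⊆ E(G) ∧ ∀ C ≤ G, C.IsCycleGraph → ¬ E(C) ⊆ I

/-- The incidence vector modulo two of an edge (auxiliary, for the matroid axioms). -/
noncomputable def incVec (G : Graph α β) (e : β) : α →₀ ZMod 2 :=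
  open Classical in
  if h : ∃ p : α × α, G.IsLink e p.1 p.2 then
    Finsupp.single h.choose.1 1 + Finsupp.single h.choose.2 1 else 0

lemma IsLink.incVec_eq {G : Graph α β} {e : β} {x y : α} (h : G.IsLink e x y) :
    G.incVec e = Finsupp.single x 1 + Finsupp.single y 1 := by
  have hex : ∃ p : α × α, G.IsLink e p.1 p.2 := ⟨(x, y), h⟩
  unfold incVec
  rw [dif_pos hex]
  rcases hex.choose_spec.eq_and_eq_or_eq_and_eq h with ⟨h1, h2⟩ | ⟨h1, h2⟩
  · rw [h1, h2]
  · rw [h1, h2, add_comm]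

lemma IsCycleOfLength.exists_sum_incVec {G C : Graph α β} {n : ℕ} (hCG : C ≤ G)
    (hC : C.IsCycleOfLength n) :
    ∃ s : Finset β, s.Nonempty ∧ (s : Set β) = E(C) ∧ ∑ e ∈ s, G.incVec e = 0 := by
  classical
  obtain ⟨hn, v, e, -, he, -, hE, hl⟩ := hC
  have : NeZero n := ⟨hn⟩
  refine ⟨Finset.univ.image e, ⟨e 0, by simp⟩, by simpa using hE, ?_⟩
  rw [Finset.sum_image (fun a _ b _ h => he h)]
  have h1 : ∀ i, G.incVec (e i) = Finsupp.single (v i) 1 + Finsupp.single (v (i + 1)) 1 :=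
    fun i => ((hl i).mono hCG).incVec_eq
  simp_rw [h1]
  have h2 : ∑ i, Finsupp.single (v (i + 1)) (1 : ZMod 2) = ∑ i, Finsupp.single (v i) 1 :=
    Equiv.sum_comp (Equiv.addRight (1 : ZMod n)) (fun i => Finsupp.single (v i) (1 : ZMod 2))
  rw [Finset.sum_add_distrib, h2]
  ext z
  simp [CharTwo.add_self_eq_zero]

/-- The graph on `α` whose edges are the pairs of distinct vertices joined by an edge in `I`. -/
def linkGraph (G : Graph α β) (I : Set β) : SimpleGraph α where
  Adj x y := x ≠ y ∧ ∃ f ∈ I, G.IsLink f x y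
  symm := ⟨fun _ _ h => ⟨h.1.symm, h.2.imp fun _ hf => ⟨hf.1, hf.2.symm⟩⟩⟩
  loopless := ⟨fun _ h => h.1 rfl⟩

lemma exists_isCycleGraph_of_reachable {G : Graph α β} {I : Set β} {e : β} {x y : α}
    (he : G.IsLink e x y) (heI : e ∉ I) (h : (G.linkGraph I).Reachable x y) :
    ∃ C ≤ G, C.IsCycleGraph ∧ E(C) ⊆ insert e I := by
  classical
  obtain ⟨p, hp⟩ := h.exists_isPath
  set l := p.length with hl
  have hf : ∀ i : ℕ, ∃ f, (i < l → f ∈ I ∧ G.IsLink f (p.getVert i) (p.getVert (i + 1))) ∧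
      (l ≤ i → f = e) := by
    intro i
    by_cases hi : i < l
    · obtain ⟨-, f, hf⟩ := p.adj_getVert_succ hi
      exact ⟨f, fun _ => hf, fun h => absurd hi (by omega)⟩
    · exact ⟨e, fun h => absurd h hi, fun _ => rfl⟩
  choose f hf1 hf2 using hf
  have hinj := hp.getVert_injOn
  let v : ZMod (l + 1) → α := fun i => p.getVert i.val
  let g : ZMod (l + 1) → β := fun i => f i.val
  have hlt : ∀ i : ZMod (l + 1), i.val < l + 1 := fun i => ZMod.val_lt i
  have hv : Function.Injective v := by
    intro i j hij
    have := hlt i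
    have := hlt j
    refine ZMod.val_injective _ (hinj ?_ ?_ hij) <;> simp <;> omega
  have hlink : ∀ i, G.IsLink (g i) (v i) (v (i + 1)) := by
    intro i
    have h1 := hlt i
    have hs : (i + 1).val = (i.val + 1) % (l + 1) := by
      rw [ZMod.val_add]
      rcases Nat.eq_zero_or_pos l with h0 | h0
      · simp [h0, Nat.mod_one]
      · rw [ZMod.val_one'' (by omega)]
    by_cases hi : i.val < l
    · have := (hf1 _ hi).2
      simp only [g, v, hs]
      rwa [Nat.mod_eq_of_lt (by omega)]
    · have hil : i.val = l := by omega
      simp only [g, v, hs]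
      rw [hf2 _ (by omega), hil, Nat.mod_self, p.getVert_zero, hl, p.getVert_length]
      exact he.symm
  have hg : Function.Injective g := by
    intro i j hij
    have h1 := hlt i
    have h2 := hlt j
    apply ZMod.val_injective
    by_cases hi : i.val < l <;> by_cases hj : j.val < l
    · have hi' := (hf1 _ hi).2
      have hj' := (hf1 _ hj).2
      simp only [g] at hij
      rw [hij] at hi'
      rcases hi'.eq_and_eq_or_eq_and_eq hj' with ⟨h3, -⟩ | ⟨h3, h4⟩
      · exact hinj (by simp; omega) (by simp; omega) h3
      · have h3 := hinj (by simp; omega) (by simp; omega) h3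
        have h4 := hinj (by simp; omega) (by simp; omega) h4
        omega
    · have h3 : f i.val = e := hij.trans (hf2 j.val (by omega))
      exact absurd (h3 ▸ (hf1 _ hi).1) heI
    · have h3 : f j.val = e := hij.symm.trans (hf2 i.val (by omega))
      exact absurd (h3 ▸ (hf1 _ hj).1) heI
    · omega
  refine ⟨{ vertexSet := Set.range v
            IsLink := fun b a c => b ∈ Set.range g ∧ G.IsLink b a c
            edgeSet := Set.range g
            isLink_symm := fun b _ => ⟨fun a c h => ⟨h.1, h.2.symm⟩⟩
            eq_or_eq_of_isLink_of_isLink := fun b a c a' c' h h' => h.2.left_eq_or_eq h'.2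
            edge_mem_iff_exists_isLink := ?_
            left_mem_of_isLink := ?_ }, ⟨?_, ?_⟩, ?_, ?_⟩
  · intro b
    constructor
    · rintro ⟨i, rfl⟩
      exact ⟨_, _, ⟨i, rfl⟩, hlink i⟩
    · rintro ⟨_, _, h, _⟩
      exact h
  · rintro _ a c ⟨⟨i, rfl⟩, h⟩
    rcases h.left_eq_or_eq (hlink i) with rfl | rfl
    · exact ⟨_, rfl⟩
    · exact ⟨_, rfl⟩
  · rintro _ ⟨i, rfl⟩
    exact (hlink i).left_mem
  · intro b a c h
    exact h.2
  · exact ⟨l + 1, by omega, v, g, hv, hg, rfl, rfl, fun i => ⟨⟨i, rfl⟩, hlink i⟩⟩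
  · rintro _ ⟨i, rfl⟩
    by_cases hi : i.val < l
    · exact Or.inr (hf1 _ hi).1
    · exact Or.inl (hf2 _ (by omega))

lemma isAcyclicSet_iff {G : Graph α β} {I : Set β} :
    G.IsAcyclicSet I ↔ I ⊆ E(G) ∧ LinearIndepOn (ZMod 2) G.incVec I := by
  classical
  refine and_congr_right fun hI => ⟨fun h => ?_, ?_⟩
  · rw [linearIndepOn_iff_notMem_span]
    intro e heI hspan
    obtain ⟨x, y, hxy⟩ := exists_isLink_of_mem_edgeSet (hI heI)
    by_cases hr : (G.linkGraph (I \ {e})).Reachable x y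
    · obtain ⟨C, hCG, hC, hCI⟩ := exists_isCycleGraph_of_reachable hxy (by simp) hr
      refine h C hCG hC (hCI.trans ?_)
      rintro b (rfl | hb)
      · exact heI
      · exact hb.1
    · let φ : (α →₀ ZMod 2) →ₗ[ZMod 2] ZMod 2 := Finsupp.linearCombination (ZMod 2)
        (fun z => if (G.linkGraph (I \ {e})).Reachable x z then (1 : ZMod 2) else 0)
      have hle : Submodule.span (ZMod 2) (G.incVec '' (I \ {e})) ≤ LinearMap.ker φ := by
        rw [Submodule.span_le]
        rintro _ ⟨f, hf, rfl⟩
        obtain ⟨a, c, hac⟩ := exists_isLink_of_mem_edgeSet (hI hf.1)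
        have hiff : (G.linkGraph (I \ {e})).Reachable x a ↔
            (G.linkGraph (I \ {e})).Reachable x c := by
          by_cases hne : a = c
          · rw [hne]
          · have : (G.linkGraph (I \ {e})).Reachable a c :=
              SimpleGraph.Adj.reachable ⟨hne, f, hf, hac⟩
            exact ⟨fun h => h.trans this, fun h => h.trans this.symm⟩
        simp only [SetLike.mem_coe, LinearMap.mem_ker]
        rw [hac.incVec_eq]
        simp [φ, hiff, CharTwo.add_self_eq_zero]
      have := hle hspan
      rw [LinearMap.mem_ker, hxy.incVec_eq] at this
      simp [φ, hr] at this
  · rintro h C hCG ⟨n, hC⟩ hCI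
    obtain ⟨s, ⟨b, hb⟩, hs, hsum⟩ := hC.exists_sum_incVec hCG
    rw [linearIndepOn_iff'] at h
    have := h s (fun _ => 1) (hs ▸ hCI) (by simpa using hsum) b hb
    exact one_ne_zero this

/-- The cycle matroid of a multigraph: its ground set is the edge set, and its independent sets
are the acyclic sets of edges. -/
noncomputable def cycleMatroid (G : Graph α β) : Matroid β :=
  IndepMatroid.matroid <| IndepMatroid.ofFinitaryCardAugment E(G) G.IsAcyclicSet
    (by rw [isAcyclicSet_iff]; exact ⟨Set.empty_subset _, linearIndepOn_empty _ _⟩)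
    (fun _ _ hJ hIJ => ⟨hIJ.trans hJ.1, fun C hC hC' h => hJ.2 C hC hC' (h.trans hIJ)⟩)
    (by
      intro I J hI hIf hJ hJf hlt
      simp only [isAcyclicSet_iff] at hI hJ ⊢
      by_contra! hcon
      have hsub : ∀ e ∈ J, G.incVec e ∈ Submodule.span (ZMod 2) (G.incVec '' I) := by
        intro e heJ
        by_contra hspan
        by_cases heI : e ∈ I
        · exact hspan (Submodule.subset_span ⟨e, heI, rfl⟩)
        · exact hcon e heJ heI (Set.insert_subset (hJ.1 heJ) hI.1) (hI.2.insert hspan)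
      have h1 : Module.finrank (ZMod 2) (Submodule.span (ZMod 2) (G.incVec '' J)) = J.ncard := by
        have := hJf.fintype
        rw [Set.image_eq_range, finrank_span_eq_card hJ.2.linearIndependent,
          Set.ncard_eq_toFinset_card', Set.toFinset_card]
      have h2 : Module.finrank (ZMod 2) (Submodule.span (ZMod 2) (G.incVec '' I)) = I.ncard := by
        have := hIf.fintype
        rw [Set.image_eq_range, finrank_span_eq_card hI.2.linearIndependent,
          Set.ncard_eq_toFinset_card', Set.toFinset_card]
      have hfin : FiniteDimensional (ZMod 2) (Submodule.span (ZMod 2) (G.incVec '' I)) :=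
        FiniteDimensional.span_of_finite _ (hIf.image _)
      have hle := Submodule.finrank_mono (Submodule.span_le.2 (by
        rintro _ ⟨e, he, rfl⟩
        exact hsub e he) : Submodule.span (ZMod 2) (G.incVec '' J) ≤
          Submodule.span (ZMod 2) (G.incVec '' I))
      omega)
    (by
      intro I h
      refine ⟨fun e he => (h {e} (by simpa using he) (Set.finite_singleton e)).1 rfl, ?_⟩
      rintro C hCG ⟨n, hC⟩ hCI
      obtain ⟨s, -, hs, -⟩ := hC.exists_sum_incVec hCG
      exact (h E(C) hCI (hs ▸ s.finite_toSet)).2 C hCG ⟨n, hC⟩ subset_rfl)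
    (fun _ h => h.1)

@[simp] lemma cycleMatroid_ground (G : Graph α β) : G.cycleMatroid.E = E(G) := rfl

@[simp] lemma cycleMatroid_indep (G : Graph α β) (I : Set β) :
    G.cycleMatroid.Indep I ↔ G.IsAcyclicSet I := Iff.rfl

end Graph

/-- The facet ideal of a (finite) matroid `M` over `k`: the ideal of the polynomial ring with one
variable for each element of `M`, generated by the square-free monomials `∏ e ∈ B, x_e` with `B` a
basis of `M` (the bases being the facets of the complex of independent sets). -/
noncomputable def Matroid.facetIdeal {β : Type*} (k : Type*) [Field k] (M : Matroid β) :
    Ideal (MvPolynomial M.E k) :=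
  Ideal.span {p | ∃ B : Finset M.E, M.IsBase (Subtype.val '' (B : Set M.E)) ∧
    p = ∏ e ∈ B, MvPolynomial.X e}

/-- The ideal of `k[x_i : i ∈ ι]` generated by all the variables. -/
noncomputable def MvPolynomial.variableIdeal (ι k : Type*) [Field k] : Ideal (MvPolynomial ι k) :=
  Ideal.span (Set.range MvPolynomial.X)

/-- The `S`-module `N` has a free resolution
`0 ← N ← S ^ b 0 ← S ^ b 1 ← S ^ b 2 ← ⋯` (exact everywhere) which is minimal with respect to the
ideal `m`: the image of each `S ^ b (i + 1) → S ^ b i` lies in `m • S ^ b i`. -/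
def HasMinimalFreeResolution {S : Type*} [CommRing S] (m : Ideal S) (N : Type*) [AddCommGroup N]
    [Module S N] (b : ℕ → ℕ) : Prop :=
  ∃ (ε : (Fin (b 0) → S) →ₗ[S] N) (d : ∀ i, (Fin (b (i + 1)) → S) →ₗ[S] (Fin (b i) → S)),
    Function.Surjective ε ∧
    LinearMap.range (d 0) = LinearMap.ker ε ∧
    (∀ i, LinearMap.range (d (i + 1)) = LinearMap.ker (d i)) ∧
    ∀ i, LinearMap.range (d i) ≤ m • (⊤ : Submodule S (Fin (b i) → S))

/-- The `j`-th elementary symmetric polynomial in `n 0, …, n (t - 1)`. -/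
def elemSymm {t : ℕ} (n : Fin t → ℕ) (j : ℕ) : ℕ :=
  ∑ A ∈ Finset.powersetCard j Finset.univ, ∏ v ∈ A, n v

/-!
Two cycles of a cactus with a common edge lie in one block, a cycle or a single loop, so they
coincide: the circuits `C v` of the cycle matroid are pairwise disjoint. The bases are therefore the
complements of the transversals of the circuits, and the facet ideal is a monomial times the product
over all `v` of the ideals `J v` generated by the products of all but one of the variables in `C v`.

A resolution of this product is built one factor at a time. Let `I` be the product so far, whose
generators do not involve the variables `x c` of the next circuit, and let `J` be the next factor.
Mapping `(a c)` to the sum of the `a c * ∏ c' ≠ c, x c'` sends `I ^ n` onto `I * J`. Divisibility by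
the primes `x c` shows that the kernel consists of the families `(x c * w c)` with `w c` in `I` and
`∑ c, w c = 0`, so it is `I ^ (n - 1)`. The resulting short exact sequence
`0 → I ^ (n - 1) → I ^ n → I * J → 0` lifts to copies of a minimal resolution of `I` by a map with
entries in the span of the `x c`, and the mapping cone of the lift is again minimal. The generating
polynomial of the Betti numbers is thus multiplied by `n + (n - 1) X`.
-/

section Resolution

open Module

variable {S : Type*} [CommRing S] {m : Ideal S}

/-- `⋯ → F 1 → F 0 → N → 0` is a resolution of `N`, not necessarily by free modules, which is
minimal with respect to the ideal `m`. -/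
structure IsMinimalResolution (m : Ideal S) {N : Type*} [AddCommGroup N] [Module S N]
    {F : ℕ → Type*} [∀ i, AddCommGroup (F i)] [∀ i, Module S (F i)]
    (ε : F 0 →ₗ[S] N) (d : ∀ i, F (i + 1) →ₗ[S] F i) : Prop where
  surjective : Function.Surjective ε
  exact_zero : Function.Exact (d 0) ε
  exact_succ : ∀ i, Function.Exact (d (i + 1)) (d i)
  mem_smul_top : ∀ i u, d i u ∈ m • (⊤ : Submodule S (F i))

lemma HasMinimalFreeResolution.exists_isMinimalResolution {N : Type*} [AddCommGroup N]
    [Module S N] {b : ℕ → ℕ} (h : HasMinimalFreeResolution m N b) :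
    ∃ (ε : (Fin (b 0) → S) →ₗ[S] N) (d : ∀ i, (Fin (b (i + 1)) → S) →ₗ[S] (Fin (b i) → S)),
      IsMinimalResolution m (F := fun i => Fin (b i) → S) ε d := by
  obtain ⟨ε, d, hε, h₀, h, hm⟩ := h
  exact ⟨ε, d, hε, LinearMap.exact_iff.2 h₀.symm, fun i => LinearMap.exact_iff.2 (h i).symm,
    fun i u => hm i (LinearMap.mem_range_self _ u)⟩

variable {M M' : Type*} [AddCommGroup M] [Module S M] [AddCommGroup M'] [Module S M']

lemma map_mem_smul_top (f : M →ₗ[S] M') {u : M} (hu : u ∈ m • (⊤ : Submodule S M)) :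
    f u ∈ m • (⊤ : Submodule S M') :=
  Submodule.smul_top_le_comap_smul_top m f hu

lemma mem_smul_top_pi {ι : Type*} [Finite ι] {y : ι → M}
    (h : ∀ c, y c ∈ m • (⊤ : Submodule S M)) : y ∈ m • (⊤ : Submodule S (ι → M)) := by
  classical
  have := Fintype.ofFinite ι
  rw [← Finset.univ_sum_single y]
  exact Submodule.sum_mem _ fun c _ =>
    map_mem_smul_top (LinearMap.single S (fun _ : ι => M) c) (h c)

lemma mem_smul_top_prod {y : M × M'} (h₁ : y.1 ∈ m • (⊤ : Submodule S M))
    (h₂ : y.2 ∈ m • (⊤ : Submodule S M')) : y ∈ m • (⊤ : Submodule S (M × M')) := by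
  rw [← Prod.fst_add_snd y]
  exact add_mem (map_mem_smul_top (LinearMap.inl S M M') h₁)
    (map_mem_smul_top (LinearMap.inr S M M') h₂)

lemma exact_compLeft {M'' : Type*} [AddCommGroup M''] [Module S M''] {f : M →ₗ[S] M'}
    {g : M' →ₗ[S] M''} (h : Function.Exact f g) (ι : Type*) :
    Function.Exact (f.compLeft ι) (g.compLeft ι) := by
  rw [LinearMap.exact_iff] at h ⊢
  rw [LinearMap.ker_compLeft, LinearMap.range_compLeft, h]

lemma IsMinimalResolution.compLeft {N : Type*} [AddCommGroup N] [Module S N] {F : ℕ → Type*}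
    [∀ i, AddCommGroup (F i)] [∀ i, Module S (F i)] {ε : F 0 →ₗ[S] N}
    {d : ∀ i, F (i + 1) →ₗ[S] F i} (h : IsMinimalResolution m ε d) (ι : Type*) [Finite ι] :
    IsMinimalResolution m (F := fun i => ι → F i) (ε.compLeft ι) fun i => (d i).compLeft ι where
  surjective := h.surjective.comp_left
  exact_zero := exact_compLeft h.exact_zero ι
  exact_succ i := exact_compLeft (h.exact_succ i) ι
  mem_smul_top i u := mem_smul_top_pi fun c => h.mem_smul_top i (u c)

lemma hasMinimalFreeResolution_of_finrank_eq [Nontrivial S] {N : Type*} [AddCommGroup N]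
    [Module S N] {b : ℕ → ℕ}
    {M₀ : Type*} [AddCommGroup M₀] [Module S M₀] [Module.Free S M₀] [Module.Finite S M₀]
    {M : ℕ → Type*} [∀ i, AddCommGroup (M i)] [∀ i, Module S (M i)] [∀ i, Module.Free S (M i)]
    [∀ i, Module.Finite S (M i)]
    (hb₀ : finrank S M₀ = b 0) (hb : ∀ i, finrank S (M i) = b (i + 1))
    {ε : M₀ →ₗ[S] N} {d₀ : M 0 →ₗ[S] M₀} {d : ∀ i, M (i + 1) →ₗ[S] M i}
    (hε : Function.Surjective ε) (h₀ : Function.Exact d₀ ε) (h₁ : Function.Exact (d 0) d₀)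
    (h : ∀ i, Function.Exact (d (i + 1)) (d i))
    (hm₀ : ∀ u, d₀ u ∈ m • (⊤ : Submodule S M₀))
    (hm : ∀ i u, d i u ∈ m • (⊤ : Submodule S (M i))) :
    HasMinimalFreeResolution m N b := by
  have e₀ : M₀ ≃ₗ[S] (Fin (b 0) → S) := LinearEquiv.ofFinrankEq _ _ (by simpa using hb₀)
  have e : ∀ i, M i ≃ₗ[S] (Fin (b (i + 1)) → S) := fun i =>
    LinearEquiv.ofFinrankEq _ _ (by simpa using hb i)
  refine ⟨ε ∘ₗ e₀.symm.toLinearMap, fun i => match i with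
    | 0 => e₀.toLinearMap ∘ₗ d₀ ∘ₗ (e 0).symm.toLinearMap
    | i + 1 => (e i).toLinearMap ∘ₗ d i ∘ₗ (e (i + 1)).symm.toLinearMap,
    hε.comp e₀.symm.surjective, ?_, fun i => ?_, fun i => ?_⟩
  · refine (LinearMap.exact_iff.1 ?_).symm
    exact .of_ladder_linearEquiv_of_exact (e₁ := e 0) (e₂ := e₀) (e₃ := .refl S N)
      (by ext; simp) (by ext; simp) h₀
  · refine (LinearMap.exact_iff.1 ?_).symm
    rcases i with _ | i
    · exact .of_ladder_linearEquiv_of_exact (e₁ := e 1) (e₂ := e 0) (e₃ := e₀)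
        (by ext; simp) (by ext; simp) h₁
    · exact .of_ladder_linearEquiv_of_exact (e₁ := e (i + 2)) (e₂ := e (i + 1)) (e₃ := e i)
        (by ext; simp) (by ext; simp) (h i)
  · rintro _ ⟨u, rfl⟩
    rcases i with _ | i
    · exact map_mem_smul_top e₀.toLinearMap (hm₀ _)
    · exact map_mem_smul_top (e i).toLinearMap (hm i _)

lemma hasMinimalFreeResolution_span_singleton [IsDomain S] {a : S} (ha : a ≠ 0) {b : ℕ → ℕ}
    (hb₀ : b 0 = 1) (hb : ∀ i, b (i + 1) = 0) :
    HasMinimalFreeResolution m (Ideal.span {a}) b :=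
  hasMinimalFreeResolution_of_finrank_eq (M₀ := S) (M := fun _ => PUnit)
    (d₀ := 0) (d := fun _ => 0) (by simp [hb₀]) (by simp [hb, finrank_eq_zero_of_subsingleton])
    (LinearEquiv.toSpanNonzeroSingleton S S a ha).surjective
    (LinearMap.exact_zero_iff_injective _ _ |>.2 <| LinearEquiv.injective _)
    (fun _ => by simp) (fun _ _ => by simp) (fun _ => by simp) fun _ _ => zero_mem _

/-! ### Mapping cones -/

section Cone

variable {A₂ A₁ A₀ B₃ B₂ B₁ B₀ : Type*} [AddCommGroup A₂] [AddCommGroup A₁] [AddCommGroup A₀]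
  [AddCommGroup B₃] [AddCommGroup B₂] [AddCommGroup B₁] [AddCommGroup B₀] [Module S A₂]
  [Module S A₁] [Module S A₀] [Module S B₃] [Module S B₂] [Module S B₁] [Module S B₀]

/-- One differential of the mapping cone of a chain map `f` from the complex with differential `α`
to the one with differential `β`. -/
def coneDifferential (β : B₁ →ₗ[S] B₀) (f : A₁ →ₗ[S] B₀) (α : A₁ →ₗ[S] A₀) :
    B₁ × A₁ →ₗ[S] B₀ × A₀ :=
  (β.coprod f).prod (-(α ∘ₗ LinearMap.snd S B₁ A₁))

@[simp] lemma coneDifferential_apply (β : B₁ →ₗ[S] B₀) (f : A₁ →ₗ[S] B₀) (α : A₁ →ₗ[S] A₀)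
    (y : B₁ × A₁) : coneDifferential β f α y = (β y.1 + f y.2, -α y.2) :=
  rfl

lemma exact_coneDifferential {β₂ : B₂ →ₗ[S] B₁} {β₁ : B₁ →ₗ[S] B₀} {α₂ : A₂ →ₗ[S] A₁}
    {α₁ : A₁ →ₗ[S] A₀} {f₂ : A₂ →ₗ[S] B₁} {f₁ : A₁ →ₗ[S] B₀} (hβ : Function.Exact β₂ β₁)
    (hα : Function.Exact α₂ α₁) (hf : ∀ w, β₁ (f₂ w) = f₁ (α₂ w)) :
    Function.Exact (coneDifferential β₂ f₂ α₂) (coneDifferential β₁ f₁ α₁) := by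
  rintro ⟨u, w⟩
  simp only [coneDifferential_apply, Prod.mk_eq_zero, neg_eq_zero, Set.mem_range, Prod.exists,
    Prod.mk.injEq]
  constructor
  · rintro ⟨hu, hw⟩
    obtain ⟨w', rfl⟩ := (hα w).1 hw
    obtain ⟨u', hu'⟩ := (hβ (u + f₂ w')).1 (by rw [map_add, hf, hu])
    exact ⟨u', -w', by simp [hu'], by simp⟩
  · rintro ⟨u', w', rfl, rfl⟩
    simp [hβ.apply_apply_eq_zero, hα.apply_apply_eq_zero, hf]

end Cone

/-- The mapping cone of a lift of `φ` resolves the cokernel of `φ`. -/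
lemma hasMinimalFreeResolution_of_shortExact [Nontrivial S] {N P Q : Type*}
    [AddCommGroup N] [AddCommGroup P] [AddCommGroup Q] [Module S N] [Module S P] [Module S Q]
    {φ : N →ₗ[S] P} {π : P →ₗ[S] Q} (hφ : Function.Injective φ) (hφπ : Function.Exact φ π)
    (hπ : Function.Surjective π)
    {F G : ℕ → Type*} [∀ i, AddCommGroup (F i)] [∀ i, Module S (F i)]
    [∀ i, Module.Free S (F i)] [∀ i, Module.Finite S (F i)]
    [∀ i, AddCommGroup (G i)] [∀ i, Module S (G i)]
    [∀ i, Module.Free S (G i)] [∀ i, Module.Finite S (G i)]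
    {εF : F 0 →ₗ[S] N} {dF : ∀ i, F (i + 1) →ₗ[S] F i} (hF : IsMinimalResolution m εF dF)
    {εG : G 0 →ₗ[S] P} {dG : ∀ i, G (i + 1) →ₗ[S] G i} (hG : IsMinimalResolution m εG dG)
    {f : ∀ i, F i →ₗ[S] G i} (hf₀ : ∀ u, εG (f 0 u) = φ (εF u))
    (hf : ∀ i u, dG i (f (i + 1) u) = f i (dF i u))
    (hfm : ∀ i u, f i u ∈ m • (⊤ : Submodule S (G i)))
    {b : ℕ → ℕ} (hb₀ : b 0 = finrank S (G 0))
    (hb : ∀ i, b (i + 1) = finrank S (G (i + 1)) + finrank S (F i)) :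
    HasMinimalFreeResolution m Q b := by
  have hexact : Function.Exact (coneDifferential (dG 0) (f 0) εF)
      (coneDifferential εG φ (0 : N →ₗ[S] PUnit)) :=
    exact_coneDifferential hG.exact_zero
      ((LinearMap.exact_zero_iff_surjective _ _).2 hF.surjective) hf₀
  have hker : ∀ y, (dG 0).coprod (f 0) y = 0 ↔ coneDifferential (dG 0) (f 0) εF y = 0 := by
    rintro ⟨u, w⟩
    suffices dG 0 u + f 0 w = 0 → εF w = 0 by simpa
    intro h
    rw [← map_eq_zero_iff φ hφ, ← hf₀, eq_neg_of_add_eq_zero_right h, map_neg,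
      hG.exact_zero.apply_apply_eq_zero, neg_zero]
  have hexact₀ : Function.Exact ((dG 0).coprod (f 0)) (π ∘ₗ εG) := by
    refine fun g => ⟨fun hg => ?_, ?_⟩
    · obtain ⟨z, hz⟩ := (hφπ (εG g)).1 hg
      obtain ⟨y, hy⟩ := (hexact (g, -z)).1 (by simp [hz])
      exact ⟨y, congrArg Prod.fst hy⟩
    · rintro ⟨y, rfl⟩
      simp [hG.exact_zero.apply_apply_eq_zero, hf₀, hφπ.apply_apply_eq_zero]
  exact hasMinimalFreeResolution_of_finrank_eq (M₀ := G 0) (M := fun i => G (i + 1) × F i)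
    (ε := π ∘ₗ εG) (d₀ := (dG 0).coprod (f 0))
    (d := fun i => coneDifferential (dG (i + 1)) (f (i + 1)) (dF i))
    hb₀.symm (fun i => by rw [hb, finrank_prod]) (hπ.comp hG.surjective) hexact₀
    (fun y => (hker y).trans <|
      exact_coneDifferential (hG.exact_succ 0) hF.exact_zero (hf 0) y)
    (fun i => exact_coneDifferential (hG.exact_succ _) (hF.exact_succ i) (hf (i + 1)))
    (fun y => add_mem (hG.mem_smul_top 0 y.1) (hfm 0 y.2))
    fun i y => mem_smul_top_prod (add_mem (hG.mem_smul_top _ y.1) (hfm _ y.2))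
      (neg_mem (hF.mem_smul_top i y.2))

section SumMul

variable {ι : Type*} [Fintype ι] (I : Ideal S)

/-- The map `(a c)_c ↦ ∑ c, a c * y c` on families of elements of `I`. -/
def sumMul (y : ι → S) : (ι → I) →ₗ[S] S := ∑ c, y c • (I.subtype ∘ₗ LinearMap.proj c)

lemma sumMul_apply (y : ι → S) (a : ι → I) : sumMul I y a = ∑ c, a c * y c := by
  simp [sumMul, mul_comm]

lemma range_sumMul (y : ι → S) :
    LinearMap.range (sumMul I y) = I * Ideal.span (Set.range y) := by
  have h : sumMul I y ∘ₗ (Finsupp.linearEquivFunOnFinite S I ι).toLinearMap =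
      Ideal.finsuppTotal ι S I y :=
    LinearMap.ext fun a => by simp [sumMul_apply, Ideal.finsuppTotal_apply_eq_of_fintype]
  rw [← smul_eq_mul, ← Ideal.range_finsuppTotal, ← h, LinearEquiv.range_comp]

end SumMul

/-! ### The products of all but one of a family of elements -/

section Syzygy

open Finset

variable {ι : Type*} [Fintype ι] [DecidableEq ι] (M) (x : ι → S) (c₀ : ι)

/-- The product of all members of the family `x` but `x c`. -/
def prodErase (c : ι) : S := ∏ c' ∈ univ.erase c, x c'

/-- The ideal generated by the products of all but one member of the family `x`. -/
def prodEraseIdeal : Ideal S := Ideal.span (Set.range (prodErase x))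

/-- The map sending `(w c)_{c ≠ c₀}` to `(x c • w c)_c`, where `w c₀` is chosen so that the `w c`
have sum zero. For `M = S` it parametrises the syzygies of the products `prodErase x c`. -/
def syzygyMap : ({c // c ≠ c₀} → M) →ₗ[S] (ι → M) :=
  LinearMap.pi fun c => x c • if h : c = c₀ then -∑ c, LinearMap.proj c
    else LinearMap.proj ⟨c, h⟩

variable {M}

lemma mul_prodErase (c : ι) : x c * prodErase x c = ∏ c', x c' :=
  mul_prod_erase _ _ (mem_univ c)

@[simp] lemma syzygyMap_apply_self (w : {c // c ≠ c₀} → M) :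
    syzygyMap M x c₀ w c₀ = x c₀ • -∑ c, w c := by
  simp [syzygyMap]

@[simp] lemma syzygyMap_apply_coe (w : {c // c ≠ c₀} → M) (c : {c // c ≠ c₀}) :
    syzygyMap M x c₀ w c = x c • w c := by
  simp [syzygyMap, c.2]

lemma eq_syzygyMap_iff {w : {c // c ≠ c₀} → M} {a : ι → M} :
    a = syzygyMap M x c₀ w ↔ a c₀ = x c₀ • -∑ c, w c ∧ ∀ c : {c // c ≠ c₀}, a c = x c • w c := by
  refine ⟨fun h => by simp [h], fun ⟨h₀, h⟩ => funext fun c => ?_⟩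
  by_cases hc : c = c₀
  · rw [hc, h₀, syzygyMap_apply_self]
  · exact (h ⟨c, hc⟩).trans (syzygyMap_apply_coe x c₀ w ⟨c, hc⟩).symm

lemma compLeft_syzygyMap (f : M →ₗ[S] M') (w : {c // c ≠ c₀} → M) :
    f.compLeft ι (syzygyMap M x c₀ w) = syzygyMap M' x c₀ (f.compLeft _ w) := by
  simp [eq_syzygyMap_iff]

variable {x c₀}

lemma syzygyMap_mem_smul_top (hx : ∀ c, x c ∈ m) (w : {c // c ≠ c₀} → M) :
    syzygyMap M x c₀ w ∈ m • (⊤ : Submodule S (ι → M)) :=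
  mem_smul_top_pi fun c => Submodule.smul_mem_smul (hx c) trivial

lemma syzygyMap_injective (hx : ∀ c ≠ c₀, IsSMulRegular M (x c)) :
    Function.Injective (syzygyMap M x c₀) := by
  intro w w' h
  ext c
  refine hx c c.2 ?_
  simpa using congr_fun h c

lemma dvd_of_sum_mul_prodErase_eq_zero [IsDomain S] (hx : ∀ c, Prime (x c))
    (hd : ∀ c c', c ≠ c' → ¬ x c ∣ x c') {a : ι → S} (ha : ∑ c, a c * prodErase x c = 0) (c : ι) :
    x c ∣ a c := by
  have hdvd : x c ∣ a c * prodErase x c := by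
    rw [← add_sum_erase _ _ (mem_univ c)] at ha
    rw [eq_neg_of_add_eq_zero_left ha, dvd_neg]
    exact dvd_sum fun c' hc' => Dvd.dvd.mul_left
      (dvd_prod_of_mem _ (mem_erase.2 ⟨(ne_of_mem_erase hc').symm, mem_univ c⟩)) _
  refine ((hx c).dvd_or_dvd hdvd).resolve_right fun h => ?_
  obtain ⟨c', hc', hcc'⟩ := (hx c).exists_mem_finset_dvd h
  exact hd c c' (ne_of_mem_erase hc').symm hcc'

lemma sum_mul_prodErase_eq_zero_iff [IsDomain S] (hx : ∀ c, Prime (x c))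
    (hd : ∀ c c', c ≠ c' → ¬ x c ∣ x c') {a : ι → S} :
    ∑ c, a c * prodErase x c = 0 ↔ ∃ w, syzygyMap S x c₀ w = a := by
  have hprod : ∏ c, x c ≠ 0 := prod_ne_zero_iff.2 fun c _ => (hx c).ne_zero
  have hmul (c : ι) (r : S) : x c * r * prodErase x c = r * ∏ c, x c := by
    rw [← mul_prodErase x c]; ring
  have hsum (b : ι → S) : ∑ c, b c = b c₀ + ∑ c : {c // c ≠ c₀}, b c :=
    Fintype.sum_eq_add_sum_subtype_ne b c₀
  constructor
  · intro ha
    choose b hb using dvd_of_sum_mul_prodErase_eq_zero hx hd ha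
    obtain rfl : a = fun c => x c * b c := funext hb
    simp only [hmul, ← sum_mul] at ha
    rw [mul_eq_zero_iff_right hprod, hsum] at ha
    refine ⟨fun c => b c, Eq.symm ?_⟩
    simp [eq_syzygyMap_iff, eq_neg_of_add_eq_zero_left ha]
  · rintro ⟨w, rfl⟩
    rw [hsum]
    simp only [syzygyMap_apply_self, syzygyMap_apply_coe, smul_eq_mul, hmul, ← sum_mul]
    rw [← add_mul, neg_add_cancel, zero_mul]

lemma exact_syzygyMap_sumMul [IsDomain S] (hx : ∀ c, Prime (x c))
    (hd : ∀ c c', c ≠ c' → ¬ x c ∣ x c') {I : Ideal S} (hxI : ∀ c f, x c * f ∈ I → f ∈ I) :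
    Function.Exact (syzygyMap I x c₀) (sumMul I (prodErase x)) := by
  intro a
  rw [sumMul_apply, sum_mul_prodErase_eq_zero_iff (c₀ := c₀) hx hd]
  constructor
  · rintro ⟨w, hw⟩
    have hwI (c : {c // c ≠ c₀}) : w c ∈ I := by
      refine hxI c _ ?_
      rw [← smul_eq_mul, ← syzygyMap_apply_coe, hw]
      exact (a c).2
    refine ⟨fun c => ⟨w c, hwI c⟩, I.subtype_injective.comp_left ?_⟩
    exact (compLeft_syzygyMap x c₀ I.subtype _).trans hw
  · rintro ⟨w, rfl⟩
    exact ⟨_, (compLeft_syzygyMap x c₀ I.subtype w).symm⟩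

/-- The cone of `syzygyMap`, from `|ι| - 1` to `|ι|` copies of a resolution of `I`. -/
lemma HasMinimalFreeResolution.mul_prodEraseIdeal [IsDomain S] [Nonempty ι] {I : Ideal S}
    {b b' : ℕ → ℕ} (h : HasMinimalFreeResolution m I b) (hx : ∀ c, Prime (x c))
    (hd : ∀ c c', c ≠ c' → ¬ x c ∣ x c') (hxm : ∀ c, x c ∈ m)
    (hxI : ∀ c f, x c * f ∈ I → f ∈ I) (hb₀ : b' 0 = Fintype.card ι * b 0)
    (hb : ∀ i, b' (i + 1) = Fintype.card ι * b (i + 1) + (Fintype.card ι - 1) * b i) :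
    HasMinimalFreeResolution m ↥(I * prodEraseIdeal x) b' := by
  obtain ⟨c₀⟩ := ‹Nonempty ι›
  obtain ⟨ε, d, hε⟩ := h.exists_isMinimalResolution
  have hexact := exact_syzygyMap_sumMul (c₀ := c₀) hx hd hxI
  have hinj : Function.Injective (syzygyMap I x c₀) :=
    syzygyMap_injective fun c _ => IsSMulRegular.of_ne_zero (hx c).ne_zero
  rw [prodEraseIdeal, ← range_sumMul]
  exact hasMinimalFreeResolution_of_shortExact (π := (sumMul I (prodErase x)).rangeRestrict)
    (f := fun i => syzygyMap (Fin (b i) → S) x c₀) hinj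
    (fun a => Subtype.ext_iff.trans (hexact a))
    (LinearMap.surjective_rangeRestrict _) (hε.compLeft {c // c ≠ c₀}) (hε.compLeft ι)
    (compLeft_syzygyMap x c₀ ε) (fun i => compLeft_syzygyMap x c₀ (d i))
    (fun i => syzygyMap_mem_smul_top hxm) (by simp [finrank_pi_fintype, hb₀])
    (fun i => by simp [finrank_pi_fintype, hb])

end Syzygy

end Resolution

section BettiPoly

open Polynomial Finset

variable {ι : Type*}

/-- The generating polynomial `∏ v ∈ A, (n v + (n v - 1) X)` of the Betti numbers. The truncated
subtraction is harmless because each `n v` will be the cardinality of a nonempty set. -/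
noncomputable def bettiPoly (n : ι → ℕ) (A : Finset ι) : ℕ[X] :=
  ∏ v ∈ A, (C (n v) + C (n v - 1) * X)

lemma bettiPoly_insert [DecidableEq ι] (n : ι → ℕ) {A : Finset ι} {v : ι} (hv : v ∉ A) :
    bettiPoly n (insert v A) = (C (n v) + C (n v - 1) * X) * bettiPoly n A :=
  prod_insert hv

variable [Fintype ι]

lemma coeff_prod_C_add_C_mul_X {R : Type*} [CommSemiring R] [DecidableEq ι] (a b : ι → R)
    (i : ℕ) : (∏ v, (C (a v) + C (b v) * X)).coeff i =
      ∑ A ∈ powersetCard i univ, (∏ v ∈ A, b v) * ∏ v ∈ Aᶜ, a v := by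
  have h : ∏ v, (C (a v) + C (b v) * X) =
      ∑ A : Finset ι, C ((∏ v ∈ A, b v) * ∏ v ∈ Aᶜ, a v) * X ^ #A := by
    simp_rw [add_comm (C (a _)), prod_add, powerset_univ, prod_mul_distrib, prod_const,
      ← compl_eq_univ_sdiff, C_mul, map_prod, mul_right_comm]
  simp_rw [h, finsetSum_coeff, coeff_C_mul_X_pow, powersetCard_eq_filter, powerset_univ,
    sum_filter, eq_comm]

lemma coeff_bettiPoly_eq_zero (n : ι → ℕ) {i : ℕ} (hi : Fintype.card ι < i) :
    (bettiPoly n univ).coeff i = 0 := by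
  classical
  rw [bettiPoly, coeff_prod_C_add_C_mul_X, powersetCard_eq_empty.2 (by simpa using hi), sum_empty]

lemma coeff_bettiPoly [DecidableEq ι] {n : ι → ℕ} (hn : ∀ v, n v ≠ 0) (i : ℕ) :
    ((bettiPoly n univ).coeff i : ℤ) =
      ∑ A ∈ powersetCard i univ, (∏ v ∈ A, ((n v : ℤ) - 1)) * ∏ v ∈ Aᶜ, (n v : ℤ) := by
  rw [bettiPoly, coeff_prod_C_add_C_mul_X]
  simp [Nat.cast_pred, Nat.pos_of_ne_zero (hn _)]

lemma prod_C_add_C_sub_one_mul_X {t : ℕ} (n : Fin t → ℕ) :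
    ∏ v, (C (n v : ℤ) + C ((n v : ℤ) - 1) * X) =
      ∑ j ∈ range (t + 1), C (elemSymm n (t - j) : ℤ) * ((1 + X) ^ (t - j) * (-X) ^ j) := by
  have hfactor (v : Fin t) :
      C (n v : ℤ) + C ((n v : ℤ) - 1) * X = C (n v : ℤ) * (1 + X) + -X := by
    rw [C_sub, C_1]; ring
  rw [← sum_flip]
  simp_rw [hfactor, prod_add, sum_powerset, card_univ, Fintype.card_fin]
  refine sum_congr rfl fun j hj => ?_
  rw [Nat.sub_sub_self (mem_range_succ_iff.1 hj), elemSymm, Nat.cast_sum, map_sum, sum_mul]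
  refine sum_congr rfl fun A hA => ?_
  simp [prod_mul_distrib, card_sdiff, (mem_powersetCard.1 hA).2, mul_assoc]

lemma coeff_bettiPoly_eq_sum_elemSymm {t : ℕ} {n : Fin t → ℕ} (hn : ∀ v, n v ≠ 0) {i : ℕ}
    (hi : i ≤ t) : ((bettiPoly n univ).coeff i : ℤ) = ∑ j ∈ range (i + 1),
      (-1) ^ j * ((t - j).choose (i - j) : ℤ) * (elemSymm n (t - j) : ℤ) := by
  have hcoeff (j : ℕ) : ((1 + X) ^ (t - j) * (-X) ^ j : ℤ[X]).coeff i =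
      if j ≤ i then (-1) ^ j * ((t - j).choose (i - j) : ℤ) else 0 := by
    rw [neg_pow, ← mul_assoc, coeff_mul_X_pow', ← C_1, ← C_neg, ← C_pow, coeff_mul_C, C_1,
      coeff_one_add_X_pow, mul_comm]
  rw [coeff_bettiPoly hn, ← coeff_prod_C_add_C_mul_X, prod_C_add_C_sub_one_mul_X, finsetSum_coeff]
  simp_rw [coeff_C_mul, hcoeff, mul_ite, mul_zero, ← sum_filter]
  refine sum_congr ?_ fun j _ => mul_comm _ _
  ext j
  simp only [mem_filter, mem_range]
  omega

end BettiPoly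

/-! ### Ideals generated by monomials -/

section MonomialIdeal

open MvPolynomial

variable {σ R : Type*} [CommRing R]

/-- The ideal `I` is generated by monomials that do not involve the variable `c`. -/
def IsMonomialAvoiding (c : σ) (I : Ideal (MvPolynomial σ R)) : Prop :=
  ∃ s : Set (σ →₀ ℕ), (∀ a ∈ s, a c = 0) ∧ I = Ideal.span ((fun a => monomial a (1 : R)) '' s)

namespace IsMonomialAvoiding

variable {c : σ} {I J : Ideal (MvPolynomial σ R)}

lemma mem_of_X_mul_mem (hI : IsMonomialAvoiding c I) {f : MvPolynomial σ R} (hf : X c * f ∈ I) :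
    f ∈ I := by
  classical
  obtain ⟨s, hs, rfl⟩ := hI
  rw [mem_ideal_span_monomial_image] at hf ⊢
  intro a ha
  obtain ⟨b, hb, hba⟩ := hf (Finsupp.single c 1 + a) (by
    rw [mem_support_iff, coeff_X_mul]
    exact mem_support_iff.1 ha)
  refine ⟨b, hb, fun e => ?_⟩
  by_cases he : e = c
  · rw [he, hs b hb]
    exact Nat.zero_le _
  · simpa [Finsupp.single_apply, Ne.symm he] using hba e

lemma mul (hI : IsMonomialAvoiding c I) (hJ : IsMonomialAvoiding c J) :
    IsMonomialAvoiding c (I * J) := by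
  obtain ⟨s, hs, rfl⟩ := hI
  obtain ⟨r, hr, rfl⟩ := hJ
  refine ⟨Set.image2 (· + ·) s r, ?_, ?_⟩
  · rintro _ ⟨a, ha, b, hb, rfl⟩
    simp [hs a ha, hr b hb]
  · rw [Ideal.span_mul_span, ← Set.image2_mul, Set.image2_image_left,
      Set.image2_image_right, Set.image_image2]
    simp [monomial_mul]

lemma one : IsMonomialAvoiding c (1 : Ideal (MvPolynomial σ R)) :=
  ⟨{0}, by simp, by simp [Ideal.span_singleton_one]⟩

lemma prod {ι : Type*} {A : Finset ι} {I : ι → Ideal (MvPolynomial σ R)}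
    (hI : ∀ v ∈ A, IsMonomialAvoiding c (I v)) : IsMonomialAvoiding c (∏ v ∈ A, I v) :=
  Finset.prod_induction _ _ (fun _ _ => mul) one hI

lemma span_range_prod_X {κ ι : Type*} {B : κ → Finset ι} {z : ι → σ}
    (hB : ∀ j, ∀ i ∈ B j, z i ≠ c) :
    IsMonomialAvoiding c
      (Ideal.span (Set.range fun j => (∏ i ∈ B j, X (z i) : MvPolynomial σ R))) := by
  refine ⟨Set.range fun j => ∑ i ∈ B j, Finsupp.single (z i) 1, ?_, ?_⟩
  · rintro _ ⟨j, rfl⟩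
    rw [Finsupp.finsetSum_apply]
    exact Finset.sum_eq_zero fun i hi => Finsupp.single_eq_of_ne' (hB j i hi)
  · rw [← Set.range_comp]
    simp [Function.comp_def, X, monomial_sum_one]

lemma span_prod_X {B : Finset σ} (hB : c ∉ B) :
    IsMonomialAvoiding c (Ideal.span {(∏ e ∈ B, X e : MvPolynomial σ R)}) := by
  simpa using span_range_prod_X (R := R) (B := fun _ : Unit => B) (z := id) (c := c)
    fun _ e he hec => hB (hec ▸ he)

lemma prodEraseIdeal_X [DecidableEq σ] {D : Finset σ} (hD : c ∉ D) :
    IsMonomialAvoiding c (prodEraseIdeal fun e : D => (X (e : σ) : MvPolynomial σ R)) :=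
  span_range_prod_X fun _ e _ hec => hD (hec ▸ e.2)

end IsMonomialAvoiding

lemma hasMinimalFreeResolution_mul_prod_prodEraseIdeal [IsDomain R] [DecidableEq σ] {ι : Type*}
    {m : Ideal (MvPolynomial σ R)} (hm : ∀ e, X e ∈ m) (B : Finset σ) {D : ι → Finset σ}
    (hDB : ∀ v, Disjoint (D v) B) (hD : Pairwise (Function.onFun Disjoint D))
    (hne : ∀ v, (D v).Nonempty) (A : Finset ι) :
    HasMinimalFreeResolution m
      ↥(Ideal.span {∏ e ∈ B, (X e : MvPolynomial σ R)} *
        ∏ v ∈ A, prodEraseIdeal fun e : D v => (X (e : σ) : MvPolynomial σ R))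
      (bettiPoly (fun v => (D v).card) A).coeff := by
  classical
  induction A using Finset.induction_on with
  | empty =>
    rw [Finset.prod_empty, mul_one]
    refine hasMinimalFreeResolution_span_singleton
      (Finset.prod_ne_zero_iff.2 fun e _ => X_ne_zero e) ?_ ?_ <;>
      simp [bettiPoly, Polynomial.coeff_one]
  | insert v A hv ih =>
    have havoid (c : D v) : IsMonomialAvoiding (c : σ) (Ideal.span {∏ e ∈ B, X e} *
        ∏ v ∈ A, prodEraseIdeal fun e : D v => (X (e : σ) : MvPolynomial σ R)) :=
      .mul (.span_prod_X <| Finset.disjoint_left.1 (hDB v) c.2) <| .prod fun w hw =>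
        .prodEraseIdeal_X <| Finset.disjoint_left.1 (hD (ne_of_mem_of_not_mem hw hv).symm) c.2
    have : Nonempty (D v) := (hne v).to_subtype
    rw [Finset.prod_insert hv, mul_left_comm, mul_comm, bettiPoly_insert _ hv]
    refine ih.mul_prodEraseIdeal (fun c => X_prime) (fun c c' hcc' => ?_) (fun c => hm c)
      (fun c f => (havoid c).mem_of_X_mul_mem) ?_ fun i => ?_
    · simpa [X_dvd_X, Subtype.coe_inj] using hcc'
    · simp [Polynomial.mul_coeff_zero]
    · simp [add_mul, mul_assoc]

end MonomialIdeal

/-! ### Matroids with pairwise disjoint circuits -/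

section FacetIdeal

open MvPolynomial Finset

variable {ι β : Type*}

lemma prod_compl_image_eq_mul_prod_prodErase {σ S : Type*} [CommRing S] [IsDomain S] [Fintype ι]
    [Fintype σ] [DecidableEq σ] {x : σ → S} (hx : ∀ e, x e ≠ 0) {D : ι → Finset σ}
    (hD : Pairwise (Function.onFun Disjoint D)) (c : ∀ v, D v) :
    ∏ e ∈ (univ.image fun v => (c v : σ))ᶜ, x e =
      (∏ e ∈ (univ.biUnion D)ᶜ, x e) * ∏ v, prodErase (fun e : D v => x e) (c v) := by
  have hc : Function.Injective fun v => (c v : σ) := fun v w (hvw : (c v : σ) = c w) => by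
    by_contra hne
    exact disjoint_left.1 (hD hne) (c v).2 (hvw ▸ (c w).2)
  refine mul_right_cancel₀ (prod_ne_zero_iff.2 fun v _ => hx (c v)) (b := ∏ v, x (c v)) ?_
  calc (∏ e ∈ (univ.image fun v => (c v : σ))ᶜ, x e) * ∏ v, x (c v)
      = ∏ e, x e := by
        rw [← prod_image (f := x) (g := fun v => (c v : σ)) hc.injOn, prod_compl_mul_prod]
    _ = (∏ e ∈ (univ.biUnion D)ᶜ, x e) * ∏ v, ∏ e ∈ D v, x e := by
        rw [← prod_biUnion fun v _ w _ hvw => hD hvw, prod_compl_mul_prod]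
    _ = _ := by
        simp_rw [mul_assoc, ← prod_mul_distrib, mul_comm (prodErase _ _),
          mul_prodErase (fun e : D _ => x e), prod_coe_sort]

lemma isBase_iff_exists_eq_diff_range {M : Matroid β} {C : ι → Set β}
    (hC : ∀ D, M.IsCircuit D ↔ ∃ v, C v = D) (hdisj : Pairwise (Function.onFun Disjoint C))
    {B : Set β} : M.IsBase B ↔ ∃ c : ∀ v, C v, B = M.E \ Set.range fun v => (c v : β) := by
  have hcircuit (v : ι) : M.IsCircuit (C v) := (hC _).2 ⟨v, rfl⟩
  have hindep (I : Set β) : M.Indep I ↔ (∀ v, ¬ C v ⊆ I) ∧ I ⊆ M.E := by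
    rw [Matroid.indep_iff_forall_subset_not_isCircuit']
    simp only [hC]
    aesop
  have hcompl (c : ∀ v, C v) : M.Indep (M.E \ Set.range fun v => (c v : β)) :=
    (hindep _).2 ⟨fun v h => (h (c v).2).2 ⟨v, rfl⟩, Set.sdiff_subset⟩
  rw [Matroid.isBase_iff_maximal_indep]
  constructor
  · intro hB
    have hBI := (hindep B).1 hB.prop
    choose c hcC hcB using fun v => Set.not_subset.1 (hBI.1 v)
    refine ⟨fun v => ⟨c v, hcC v⟩, hB.eq_of_subset (hcompl _) (Set.subset_sdiff.2 ⟨hBI.2, ?_⟩)⟩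
    exact Set.disjoint_right.2 (Set.forall_mem_range.2 hcB)
  · rintro ⟨c, rfl⟩
    refine ⟨hcompl c, fun I hI hle e he => ⟨hI.subset_ground he, ?_⟩⟩
    rintro ⟨v, rfl⟩
    -- Otherwise `I` contains the whole of `C v`, as no other `c w` lies in it.
    refine ((hindep I).1 hI).1 v fun f hf => ?_
    by_cases hfc : f = c v
    · exact hfc ▸ he
    · refine hle ⟨(hcircuit v).subset_ground hf, ?_⟩
      rintro ⟨w, rfl⟩
      have hwv : v ≠ w := by rintro rfl; exact hfc rfl
      exact Set.disjoint_left.1 (hdisj hwv) hf (c w).2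

variable {M : Matroid β} [Fintype M.E] [DecidableEq M.E] [Fintype ι] {C : ι → Set β}
  {D : ι → Finset M.E}

lemma isBase_image_coe_iff (hC : ∀ D, M.IsCircuit D ↔ ∃ v, C v = D)
    (hdisj : Pairwise (Function.onFun Disjoint C))
    (hD : ∀ v, Subtype.val '' (D v : Set M.E) = C v) {B : Finset M.E} :
    M.IsBase (Subtype.val '' (B : Set M.E)) ↔
      ∃ c : ∀ v, D v, B = (univ.image fun v => (c v : M.E))ᶜ := by
  have himage (c : ∀ v, D v) :
      Subtype.val '' (((univ.image fun v => (c v : M.E))ᶜ : Finset M.E) : Set M.E) =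
        M.E \ Set.range fun v => ((c v : M.E) : β) := by
    rw [coe_compl, Set.image_compl_eq_range_sdiff_image Subtype.val_injective, coe_image,
      coe_univ, Set.image_univ, ← Set.range_comp, Subtype.range_coe]
    rfl
  have himage_inj := Set.image_injective.2 (Subtype.val_injective (p := (· ∈ M.E)))
  rw [isBase_iff_exists_eq_diff_range hC hdisj]
  constructor
  · rintro ⟨c, hB⟩
    choose c' hc'D hc' using fun v => (hD v).ge (c v).2
    refine ⟨fun v => ⟨c' v, hc'D v⟩, coe_injective <| himage_inj <| hB.trans ?_⟩
    simp only [himage fun v => ⟨c' v, hc'D v⟩, hc']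
  · rintro ⟨c, rfl⟩
    exact ⟨fun v => ⟨_, (hD v).le (Set.mem_image_of_mem _ (c v).2)⟩, himage c⟩

open Pointwise in
lemma facetIdeal_eq_mul_prod_prodEraseIdeal (k : Type*) [Field k]
    (hC : ∀ D, M.IsCircuit D ↔ ∃ v, C v = D) (hdisj : Pairwise (Function.onFun Disjoint C))
    (hD : ∀ v, Subtype.val '' (D v : Set M.E) = C v) :
    M.facetIdeal k = Ideal.span {∏ e ∈ (univ.biUnion D)ᶜ, X e} *
      ∏ v, prodEraseIdeal fun e : D v => (X (e : M.E) : MvPolynomial M.E k) := by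
  have hDdisj : Pairwise (Function.onFun Disjoint D) := fun v w hvw => by
    rw [Function.onFun, ← disjoint_coe, ← Set.disjoint_image_iff Subtype.val_injective, hD, hD]
    exact hdisj hvw
  have hprod (c : ∀ v, D v) := prod_compl_image_eq_mul_prod_prodErase
    (x := fun e : M.E => (X e : MvPolynomial M.E k)) X_ne_zero hDdisj c
  simp_rw [Matroid.facetIdeal, prodEraseIdeal]
  rw [Ideal.prod_span, Ideal.span_mul_span, Set.singleton_mul]
  congr 1
  ext p
  simp only [Set.mem_ofPred_eq, isBase_image_coe_iff hC hdisj hD, Set.mem_image,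
    Set.mem_fintype_prod]
  constructor
  · rintro ⟨_, ⟨c, rfl⟩, rfl⟩
    exact ⟨_, ⟨_, fun v => ⟨c v, rfl⟩, rfl⟩, (hprod c).symm⟩
  · rintro ⟨_, ⟨g, hg, rfl⟩, rfl⟩
    choose c hc using hg
    exact ⟨_, ⟨c, rfl⟩, by simp only [hprod, hc]⟩

end FacetIdeal

/-! ### Cycles of a cactus -/

section CycleMatroid

open Graph
open scoped Graph

variable {α β : Type*} {G H K C : Graph α β}

lemma forall_zmod_of_add_one {n : ℕ} (hn : n ≠ 0) {p : ZMod n → Prop} {a : ZMod n} (ha : p a)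
    (hp : ∀ i, p i → p (i + 1)) (i : ZMod n) : p i := by
  have : NeZero n := ⟨hn⟩
  have hadd (j : ℕ) : p (a + j) := by
    induction j with
    | zero => simpa using ha
    | succ j ih => simpa [add_assoc] using hp _ ih
  simpa using hadd (i - a).val

lemma edgeSet_nonempty_of_isCycleGraph (hC : C.IsCycleGraph) : E(C).Nonempty := by
  obtain ⟨n, -, -, e, -, -, -, hE, -⟩ := hC
  exact hE ▸ ⟨e 0, 0, rfl⟩

lemma ncard_edgeSet_of_isCycleOfLength {n : ℕ} (hC : C.IsCycleOfLength n) : E(C).ncard = n := by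
  obtain ⟨-, -, e, -, he, -, hE, -⟩ := hC
  rw [← hE, ← Set.image_univ, Set.ncard_image_of_injective _ he, Set.ncard_univ, Nat.card_zmod]

lemma vertexSet_eq_of_isCycleGraph (hC : C.IsCycleGraph) (hCG : C ≤ G) :
    V(C) = {x | ∃ e ∈ E(C), G.Inc e x} := by
  obtain ⟨n, -, v, e, -, -, hV, -, hl⟩ := hC
  refine Set.Subset.antisymm (hV ▸ ?_) ?_
  · rintro _ ⟨i, rfl⟩
    exact ⟨e i, (hl i).edge_mem, (hl i).inc_left.mono hCG⟩
  · rintro x ⟨f, hf, hfx⟩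
    exact ((IsSubgraph.inc_congr hCG hf).2 hfx).vertex_mem

lemma isConnectedGraph_of_forall_reflTransGen {z : α} (hz : z ∈ V(G))
    (h : ∀ x ∈ V(G), Relation.ReflTransGen G.Adj z x) : G.IsConnectedGraph :=
  ⟨⟨z, hz⟩, fun x hx y hy => (symm_of (Relation.ReflTransGen G.Adj) (h x hx)).trans (h y hy)⟩

lemma isNonseparable_of_isCycleGraph (hC : C.IsCycleGraph) : C.IsNonseparable := by
  obtain ⟨n, hn, v, e, hv, -, hV, hE, hl⟩ := hC
  refine ⟨isConnectedGraph_of_forall_reflTransGen (hl 0).left_mem ?_, ?_⟩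
  · rw [← hV]
    rintro _ ⟨i, rfl⟩
    exact forall_zmod_of_add_one (p := fun i => Relation.ReflTransGen C.Adj (v 0) (v i)) hn .refl
      (fun i hi => hi.tail (hl i).adj) i
  -- Going around the cycle, one passes from `A` to `B` at some vertex and from `B` to `A` at
  -- another one.
  have hpass {A B : Set β} (hA : A.Nonempty) (hB : B.Nonempty) (hAB : A ∪ B = E(C))
      (hd : Disjoint A B) : ∃ i, e i ∈ A ∧ e (i + 1) ∈ B := by
    by_contra! hstay
    rw [← hE] at hAB
    obtain ⟨a, ha⟩ := hA
    obtain ⟨b, hb⟩ := hB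
    obtain ⟨i, rfl⟩ := hAB.le (.inl ha)
    obtain ⟨j, rfl⟩ := hAB.le (.inr hb)
    exact Set.disjoint_left.1 hd (forall_zmod_of_add_one (p := fun i => e i ∈ A) hn ha
      (fun l hl => (hAB.ge ⟨l + 1, rfl⟩).resolve_right (hstay l hl)) j) hb
  rintro ⟨A, B, hA, hB, hd, hAB, hsub⟩
  obtain ⟨i, hiA, hiB⟩ := hpass hA hB hAB hd
  obtain ⟨j, hjB, hjA⟩ := hpass hB hA (by rw [Set.union_comm, hAB]) hd.symm
  have hvij : v (i + 1) = v (j + 1) :=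
    hsub ⟨⟨_, hiA, (hl i).inc_right⟩, _, hiB, (hl _).inc_left⟩
      ⟨⟨_, hjA, (hl _).inc_left⟩, _, hjB, (hl j).inc_right⟩
  obtain rfl : i = j := add_right_cancel (hv hvij)
  exact Set.disjoint_left.1 hd hiA hjB

lemma edgeSet_eq_of_isCycleGraph_of_subset (hHG : H ≤ G) (hCG : C ≤ G) (hH : H.IsCycleGraph)
    (hC : C.IsCycleGraph) (hHC : E(H) ⊆ E(C)) : E(H) = E(C) := by
  classical
  obtain ⟨m, hH⟩ := hH
  obtain ⟨s, ⟨b, hb⟩, hs, hsum⟩ := hH.exists_sum_incVec hHG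
  obtain ⟨n, hn, v, e, hv, he, -, hE, hl⟩ := hC
  have : NeZero n := ⟨hn⟩
  rw [← hs, ← hE] at hHC
  have hsum_filter : ∑ i with e i ∈ s, G.incVec (e i) = 0 := by
    rw [← hsum, ← Finset.sum_preimage e s he.injOn _ fun f hf hfe => absurd (hHC hf) hfe]
    congr 1
    ext i
    simp
  have hstep (i : ZMod n) (hi : e i ∈ s) : e (i + 1) ∈ s := by
    -- Only `e i` and `e (i + 1)` contribute to the sum at the vertex `v (i + 1)`.
    have hcoeff := DFunLike.congr_fun hsum_filter (v (i + 1))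
    simp only [fun j => ((hl j).mono hCG).incVec_eq, Finsupp.finsetSum_apply, Finsupp.add_apply,
      Finsupp.single_apply, hv.eq_iff, add_left_inj, Finset.sum_add_distrib,
      Finset.sum_ite_eq', Finset.mem_filter, Finset.mem_univ, true_and, Finsupp.coe_zero,
      Pi.zero_apply, if_pos hi] at hcoeff
    by_contra hi'
    simp [hi'] at hcoeff
  obtain ⟨j, rfl⟩ := hHC hb
  rw [← hs, ← hE]
  refine hHC.antisymm ?_
  rintro _ ⟨i, rfl⟩
  exact forall_zmod_of_add_one (p := fun i => e i ∈ s) hn hb hstep i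

lemma exists_isBlock_ge (hV : V(G).Finite) (hE : E(G).Finite) (hH : H.IsNonseparable)
    (hHG : H ≤ G) : ∃ B, G.IsBlock B ∧ H ≤ B := by
  have hfin : {K : Graph α β | K ≤ G ∧ K.IsNonseparable}.Finite := by
    refine Set.Finite.of_finite_image (f := fun K => (V(K), E(K)))
      ((hV.finite_subsets.prod hE.finite_subsets).subset ?_) ?_
    · rintro _ ⟨K, ⟨hK, -⟩, rfl⟩
      exact ⟨IsSubgraph.vertexSet_mono hK, IsSubgraph.edgeSet_mono hK⟩
    · rintro K ⟨hK, -⟩ L ⟨hL, -⟩ hKL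
      exact Compatible.ext (congr_arg Prod.fst hKL) (congr_arg Prod.snd hKL) (.of_le_le hK hL)
  obtain ⟨B, hHB, hB⟩ := hfin.exists_le_maximal ⟨hHG, hH⟩
  exact ⟨B, hB, hHB⟩

lemma exists_edgeSet_eq_union_of_le (hHG : H ≤ G) (hKG : K ≤ G) :
    ∃ L ≤ G, H ≤ L ∧ K ≤ L ∧ V(L) = V(H) ∪ V(K) ∧ E(L) = E(H) ∪ E(K) := by
  let L := (G.restrict (E(H) ∪ E(K))).induce (V(H) ∪ V(K))
  have hL {e x y} : L.IsLink e x y ↔ (e ∈ E(H) ∪ E(K) ∧ G.IsLink e x y) ∧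
      x ∈ V(H) ∪ V(K) ∧ y ∈ V(H) ∪ V(K) := by
    simp [L]
  have hHL : H ≤ L := ⟨Set.subset_union_left, fun e x y h =>
    hL.2 ⟨⟨.inl h.edge_mem, h.mono hHG⟩, .inl h.left_mem, .inl h.right_mem⟩⟩
  have hKL : K ≤ L := ⟨Set.subset_union_right, fun e x y h =>
    hL.2 ⟨⟨.inr h.edge_mem, h.mono hKG⟩, .inr h.left_mem, .inr h.right_mem⟩⟩
  have hVG : V(H) ∪ V(K) ⊆ V(G) :=
    Set.union_subset (IsSubgraph.vertexSet_mono hHG) (IsSubgraph.vertexSet_mono hKG)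
  refine ⟨L, (induce_le (by simpa using hVG)).trans restrict_le, hHL, hKL, rfl,
    Set.Subset.antisymm (fun e he => ?_)
      (Set.union_subset (IsSubgraph.edgeSet_mono hHL) (IsSubgraph.edgeSet_mono hKL))⟩
  obtain ⟨x, y, h⟩ := exists_isLink_of_mem_edgeSet he
  exact (hL.1 h).1.1

lemma edgeSet_subset_or_subset_of_isNonseparable (hH : H.IsNonseparable) (hHG : H ≤ G)
    {A B : Set β} (hd : Disjoint A B) (hAB : E(H) ⊆ A ∪ B)
    (hsub : {x | (∃ e ∈ A, G.Inc e x) ∧ ∃ f ∈ B, G.Inc f x}.Subsingleton) :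
    E(H) ⊆ A ∨ E(H) ⊆ B := by
  by_contra! hcon
  obtain ⟨⟨b, hbH, hbA⟩, a, haH, haB⟩ := hcon.imp Set.not_subset.1 Set.not_subset.1
  refine hH.2 ⟨A ∩ E(H), B ∩ E(H), ⟨a, (hAB haH).resolve_right haB, haH⟩,
    ⟨b, (hAB hbH).resolve_left hbA, hbH⟩, hd.mono Set.inter_subset_left Set.inter_subset_left,
    ?_, hsub.anti ?_⟩
  · rw [← Set.union_inter_distrib_right, Set.inter_eq_self_of_subset_right hAB]
  · rintro x ⟨⟨e, he, hex⟩, f, hf, hfx⟩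
    exact ⟨⟨e, he.1, hex.mono hHG⟩, f, hf.1, hfx.mono hHG⟩

lemma exists_isNonseparable_ge_ge (hH : H.IsNonseparable) (hK : K.IsNonseparable) (hHG : H ≤ G)
    (hKG : K ≤ G) (hHK : (E(H) ∩ E(K)).Nonempty) :
    ∃ L ≤ G, L.IsNonseparable ∧ H ≤ L ∧ K ≤ L := by
  obtain ⟨L, hLG, hHL, hKL, hVL, hEL⟩ := exists_edgeSet_eq_union_of_le hHG hKG
  obtain ⟨f, hfH, hfK⟩ := hHK
  refine ⟨L, hLG, ⟨?_, ?_⟩, hHL, hKL⟩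
  · obtain ⟨z, w, hzw⟩ := exists_isLink_of_mem_edgeSet hfH
    have hzK : z ∈ V(K) := ((IsSubgraph.isLink_iff hKG hfK).2 (hzw.mono hHG)).left_mem
    refine isConnectedGraph_of_forall_reflTransGen (hzw.mono hHL).left_mem ?_
    rw [hVL]
    rintro x (hx | hx)
    · exact (hH.1.2 z hzw.left_mem x hx).lift id fun _ _ => Adj.mono hHL
    · exact (hK.1.2 z hzK x hx).lift id fun _ _ => Adj.mono hKL
  · rintro ⟨A, B, ⟨a, ha⟩, ⟨b, hb⟩, hd, hAB, hsub⟩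
    rw [hEL] at hAB
    have hnot {e : β} (hA : e ∈ A) (hB : e ∈ B) : False := Set.disjoint_left.1 hd hA hB
    obtain ⟨hHAB, hKAB⟩ := Set.union_subset_iff.1 hAB.ge
    rcases edgeSet_subset_or_subset_of_isNonseparable hH hHL hd hHAB hsub,
      edgeSet_subset_or_subset_of_isNonseparable hK hKL hd hKAB hsub with
      ⟨hHA | hHB, hKA | hKB⟩
    · exact hnot (Set.union_subset hHA hKA (hAB.le (.inr hb))) hb
    · exact hnot (hHA hfH) (hKB hfK)
    · exact hnot (hKA hfK) (hHB hfH)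
    · exact hnot ha (Set.union_subset hHB hKB (hAB.le (.inl ha)))

lemma disjoint_edgeSet_of_isCactus (hG : G.IsCactus) (hHG : H ≤ G) (hKG : K ≤ G)
    (hH : H.IsCycleGraph) (hK : K.IsCycleGraph) (hHK : H ≠ K) : Disjoint E(H) E(K) := by
  by_contra hmeet
  obtain ⟨L, hLG, hL, hHL, hKL⟩ :=
    exists_isNonseparable_ge_ge (isNonseparable_of_isCycleGraph hH)
      (isNonseparable_of_isCycleGraph hK) hHG hKG (Set.not_disjoint_iff_nonempty_inter.1 hmeet)
  obtain ⟨B, hB, hLB⟩ := exists_isBlock_ge hG.finite_vertexSet hG.finite_edgeSet hL hLG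
  have hedge {J : Graph α β} (hJG : J ≤ G) (hJB : J ≤ B) (hJ : J.IsCycleGraph) : E(J) = E(B) := by
    have hJE := IsSubgraph.edgeSet_mono hJB
    rcases hG.isCycle_or_edge_of_isBlock B hB with hBcycle | ⟨e, he⟩
    · exact edgeSet_eq_of_isCycleGraph_of_subset hJG hB.prop.1 hJ hBcycle hJE
    · rw [he] at hJE ⊢
      exact (edgeSet_nonempty_of_isCycleGraph hJ).subset_singleton_iff.1 hJE
  have hE : E(H) = E(K) :=
    (hedge hHG (hHL.trans hLB) hH).trans (hedge hKG (hKL.trans hLB) hK).symm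
  refine hHK (Compatible.ext ?_ hE (.of_le_le hHG hKG))
  rw [vertexSet_eq_of_isCycleGraph hH hHG, vertexSet_eq_of_isCycleGraph hK hKG, hE]

lemma isCircuit_cycleMatroid_iff {D : Set β} :
    G.cycleMatroid.IsCircuit D ↔ ∃ C ≤ G, C.IsCycleGraph ∧ E(C) = D := by
  have hdep (X : Set β) : G.cycleMatroid.Dep X ↔
      X ⊆ E(G) ∧ ∃ C ≤ G, C.IsCycleGraph ∧ E(C) ⊆ X := by
    rw [Matroid.Dep, cycleMatroid_indep, IsAcyclicSet, cycleMatroid_ground]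
    push Not
    tauto
  have hdep_edgeSet {C : Graph α β} (hCG : C ≤ G) (hC : C.IsCycleGraph) :
      G.cycleMatroid.Dep E(C) :=
    (hdep _).2 ⟨IsSubgraph.edgeSet_mono hCG, C, hCG, hC, subset_rfl⟩
  rw [Matroid.isCircuit_iff]
  constructor
  · rintro ⟨hD, hmin⟩
    obtain ⟨-, C, hCG, hC, hCD⟩ := (hdep D).1 hD
    exact ⟨C, hCG, hC, hmin (hdep_edgeSet hCG hC) hCD⟩
  · rintro ⟨C, hCG, hC, rfl⟩
    refine ⟨hdep_edgeSet hCG hC, fun D hD hDC => hDC.antisymm ?_⟩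
    obtain ⟨-, H, hHG, hH, hHD⟩ := (hdep D).1 hD
    rwa [← edgeSet_eq_of_isCycleGraph_of_subset hHG hCG hH hC (hHD.trans hDC)]

end CycleMatroid

theorem theorem5p1_general {β k : Type*} [Field k] (M : Matroid β) [M.Finite] {t : ℕ}
    (C : Fin t → Set β) (hC : ∀ D, M.IsCircuit D ↔ ∃ v, C v = D)
    (hdisj : Pairwise (Function.onFun Disjoint C)) (n : Fin t → ℕ) (hn : ∀ v, (C v).ncard = n v) :
    ∃ b : ℕ → ℕ,
      HasMinimalFreeResolution (MvPolynomial.variableIdeal M.E k) (M.facetIdeal k) b ∧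
      (∀ i, t < i → b i = 0) ∧
      (∀ i ≤ t, (b i : ℤ) = ∑ j ∈ Finset.range (i + 1),
        (-1) ^ j * ((t - j).choose (i - j) : ℤ) * (elemSymm n (t - j) : ℤ)) ∧
      (∀ i ≤ t, (b i : ℤ) = ∑ A ∈ Finset.powersetCard i (Finset.univ : Finset (Fin t)),
        (∏ v ∈ A, ((n v : ℤ) - 1)) * ∏ v ∈ Aᶜ, (n v : ℤ)) := by
  classical
  have : Fintype M.E := M.ground_finite.fintype
  have hcircuit (v : Fin t) : M.IsCircuit (C v) := (hC _).2 ⟨v, rfl⟩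
  let D (v : Fin t) : Finset M.E := (Subtype.val ⁻¹' C v : Set M.E).toFinset
  have hD (v : Fin t) : Subtype.val '' (D v : Set M.E) = C v := by
    simpa [D] using (hcircuit v).subset_ground
  have hDne (v : Fin t) : (D v).Nonempty := by
    rw [← Finset.coe_nonempty, ← Set.image_nonempty, hD]
    exact (hcircuit v).nonempty
  have hDdisj : Pairwise (Function.onFun Disjoint D) := fun v w hvw => by
    simpa [Function.onFun, D] using (hdisj hvw).preimage _
  have hDcard : (fun v => (D v).card) = n := funext fun v => by
    rw [← hn, ← hD, Set.ncard_image_of_injective _ Subtype.val_injective, Set.ncard_coe_finset]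
  have hn0 (v : Fin t) : n v ≠ 0 := hDcard ▸ (hDne v).card_ne_zero
  refine ⟨(bettiPoly n Finset.univ).coeff, ?_, fun i hi => coeff_bettiPoly_eq_zero n (by simpa),
    fun i => coeff_bettiPoly_eq_sum_elemSymm hn0, fun i _ => coeff_bettiPoly hn0 i⟩
  rw [facetIdeal_eq_mul_prod_prodEraseIdeal k hC hdisj hD, ← hDcard]
  exact hasMinimalFreeResolution_mul_prod_prodEraseIdeal
    (fun e => Ideal.subset_span (Set.mem_range_self e)) _
    (fun v => disjoint_compl_right.mono_left (Finset.subset_biUnion_of_mem D (Finset.mem_univ v)))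
    hDdisj hDne _

theorem theorem5p1 {α β k : Type*} [Field k] (G : Graph α β) (hG : G.IsCactus)
    (t : ℕ) (ht : 1 ≤ t) (C : Fin t → Graph α β) (hCinj : Function.Injective C)
    (hC : ∀ H : Graph α β, (∃ v, C v = H) ↔ H ≤ G ∧ H.IsCycleGraph)
    (n : Fin t → ℕ) (hn : ∀ v, (C v).IsCycleOfLength (n v)) :
    ∃ b : ℕ → ℕ,
      HasMinimalFreeResolution (MvPolynomial.variableIdeal G.cycleMatroid.E k)
        (Matroid.facetIdeal k G.cycleMatroid) b ∧
      (∀ i, t < i → b i = 0) ∧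
      (∀ i ≤ t, (b i : ℤ) = ∑ j ∈ Finset.range (i + 1),
        (-1) ^ j * ((t - j).choose (i - j) : ℤ) * (elemSymm n (t - j) : ℤ)) ∧
      (∀ i ≤ t, (b i : ℤ) = ∑ A ∈ Finset.powersetCard i (Finset.univ : Finset (Fin t)),
        (∏ v ∈ A, ((n v : ℤ) - 1)) * ∏ v ∈ Aᶜ, (n v : ℤ)) := by
  have hCG (v : Fin t) := (hC (C v)).1 ⟨v, rfl⟩
  have : G.cycleMatroid.Finite := ⟨hG.finite_edgeSet⟩
  exact theorem5p1_general G.cycleMatroid (fun v => (C v).edgeSet)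
    (fun D => by simp_rw [isCircuit_cycleMatroid_iff, ← and_assoc, ← hC]; simp)
    (fun v w hvw => disjoint_edgeSet_of_isCactus hG (hCG v).1 (hCG w).1 (hCG v).2 (hCG w).2
      (hCinj.ne hvw))
    n fun v => ncard_edgeSet_of_isCycleOfLength (hn v)
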